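/- Call $g\colon\mathbb{Z}_{\ge 0}\to\mathbb{Z}_{\ge 0}$ a \emph{cardinality transformation function} if for every finite set $N$ there are a finite set $W$ and a map $G\colon 2^N\to 2^W$ (a \emph{$g$-realizing set transformation} for $N$) such that $G(N)=W$, $|G(S)|=g(|S|)$ for all $S\subseteq N$, and $G(S)\cap G(T)=G(S\cap T)$ for all $S,T\subseteq N$. Such a $G$ is \emph{of level} $\ell\in\mathbb{Z}_{\ge 0}$ if for every $w\in W$ there is a set $S\subseteq N$ with $|S|\le \ell$ and $w\in G(S)$. A function $\ell\colon\mathbb{Z}_{\ge 0}\to\mathbb{Z}_{\ge 0}$ is a \emph{generalized level} of $g$ if for every $n$ and every set $N$ with $|N|=n$ there is a $g$-realizing set transformation for $N$ of level $\ell(n)$. \textbf{Theorem.} Let $m,p,r$ be positive integers such that $p$ is prime and $m$ is a composite number with exactly $r$ distinct prime factors. There are a constant $c>0$ and an integer $n_0$, depending only on $m$ and $p$, such that the following holds for every cardinality transformation function $g$ which satisfies, for all $x\in\mathbb{Z}_{\ge 0}$, $$g(x)\equiv\begin{cases}0 \pmod p & \text{if } x\equiv 0\pmod m,\\ 1\pmod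 p & \text{if } x\not\equiv 0\pmod m.\end{cases}$$ The function $g$ has a generalized level, and every generalized level $\ell$ of $g$ satisfies $$\ell(n)\ \ge\ c\left(\frac{\log n}{\log\log n}\right)^{r-1}\qquad\text{for all } n\ge n_0;$$ that is, $\ell(n)=\Omega\bigl((\log n/\log\log n)^{r-1}\bigr)$, with $m$ and $p$ considered constant. -/

import Mathlib

/-- `G : 2^N → 2^W` is a `g`-realizing set transformation for the finite ground set `N`.
The finite sets `N` and `W` are finite types, and `2^N`, `2^W` are `Finset N`, `Finset W`. -/
structure IsRealizingSetTransformation (g : ℕ → ℕ) {N W : Type*} [Fintype N] [DecidableEq N]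
    [Fintype W] [DecidableEq W] (G : Finset N → Finset W) : Prop where
  map_ground : G Finset.univ = Finset.univ
  card_map : ∀ S : Finset N, (G S).card = g S.card
  map_inter : ∀ S T : Finset N, G S ∩ G T = G (S ∩ T)

/-- The set transformation `G` is of level `l`: every element of the new ground set lies in the
image of some set of at most `l` elements. -/
def IsSetTransformationOfLevel {N W : Type*} (G : Finset N → Finset W) (l : ℕ) : Prop :=
  ∀ w : W, ∃ S : Finset N, S.card ≤ l ∧ w ∈ G S

/-- `g` is a cardinality transformation function: for every finite ground set `N` there are a
finite set `W` and a `g`-realizing set transformation `2^N → 2^W`. -/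
def IsCardinalityTransformationFunction (g : ℕ → ℕ) : Prop :=
  ∀ (N : Type) [Fintype N] [DecidableEq N],
    ∃ (W : Type) (_ : Fintype W) (_ : DecidableEq W) (G : Finset N → Finset W),
      IsRealizingSetTransformation g G

/-- The cardinality transformation function `g` has generalized level `l : ℕ → ℕ`: on every
ground set of cardinality `n` there is a `g`-realizing set transformation of level `l n`. -/
def HasGeneralizedLevel (g : ℕ → ℕ) (l : ℕ → ℕ) : Prop :=
  ∀ (N : Type) [Fintype N] [DecidableEq N],
    ∃ (W : Type) (_ : Fintype W) (_ : DecidableEq W) (G : Finset N → Finset W),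
      IsRealizingSetTransformation g G ∧ IsSetTransformationOfLevel G (l (Fintype.card N))

/-- `g x` is `0` modulo `p` if `m` divides `x`, and `1` modulo `p` otherwise. -/
def HasZeroOneProperty (m p : ℕ) (g : ℕ → ℕ) : Prop :=
  ∀ x : ℕ, (x ≡ 0 [MOD m] → g x ≡ 0 [MOD p]) ∧ (¬ x ≡ 0 [MOD m] → g x ≡ 1 [MOD p])

/-!
The bound holds because a level-`l` transformation makes `g` a polynomial of degree at most `l` on
`{0, …, n}`: its finite differences at `0` of every order `s` with `l < s ≤ n` vanish, that is,
`∑ i ≤ s, (-1) ^ i * s.choose i * g i = 0`. This is proved in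
`IsRealizingSetTransformation.alternating_sum_choose_eq_zero` by double counting: the alternating
sum over the subsets `T` of an `s`-set of the indicator of `w ∈ G T` vanishes for each `w`, because
`T` and `insert a T` cancel for any `a` outside a set of size at most `l` whose image contains `w`.

For `s = p ^ k` all inner binomial coefficients vanish modulo `p`, so `g (p ^ k) ≡ ± g 0 ≡ 0`
modulo `p`, and the values of `g` modulo `p` force `m ∣ p ^ k`
(`HasZeroOneProperty.dvd_prime_pow_of_level_lt`). If `m` has at least two prime factors, this is
impossible, so no power of `p` lies in `(l, n]` and the level exceeds `n / p`, which is much larger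
than the required power of `log n / log log n`. If `m` is a prime power, the required bound is
constant and the case `k = 0` shows that the level is positive.
-/

namespace IsRealizingSetTransformation

variable {g : ℕ → ℕ} {N W : Type*} [Fintype N] [DecidableEq N] [Fintype W] [DecidableEq W]
  {G : Finset N → Finset W}

theorem mono (hG : IsRealizingSetTransformation g G) {S T : Finset N} (h : S ⊆ T) :
    G S ⊆ G T := by
  rw [← Finset.inter_eq_left, hG.map_inter, Finset.inter_eq_left.2 h]

/-- Elements outside a set `T₀` with `w ∈ G T₀` do not affect whether `w` lies in an image. -/
theorem mem_map_insert_iff (hG : IsRealizingSetTransformation g G) {w : W} {T₀ : Finset N}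
    (hw : w ∈ G T₀) {a : N} (ha : a ∉ T₀) (T : Finset N) : w ∈ G (insert a T) ↔ w ∈ G T := by
  refine ⟨fun h => ?_, fun h => hG.mono (Finset.subset_insert a T) h⟩
  have h' : w ∈ G (insert a T) ∩ G T₀ := Finset.mem_inter.2 ⟨h, hw⟩
  rw [hG.map_inter, Finset.insert_inter_of_notMem ha] at h'
  exact hG.mono Finset.inter_subset_left h'

theorem alternating_sum_indicator_eq_zero (hG : IsRealizingSetTransformation g G) {l : ℕ}
    (hl : IsSetTransformationOfLevel G l) {S : Finset N} (hS : l < S.card) (w : W) :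
    ∑ T ∈ S.powerset, (-1 : ℤ) ^ T.card * (if w ∈ G T then 1 else 0) = 0 := by
  obtain ⟨T₀, hT₀, hw⟩ := hl w
  obtain ⟨a, haS, haT₀⟩ := Finset.exists_mem_notMem_of_card_lt_card (hT₀.trans_lt hS)
  rw [← Finset.insert_erase haS, Finset.sum_powerset_insert (Finset.notMem_erase a S),
    ← Finset.sum_add_distrib]
  refine Finset.sum_eq_zero fun T hT => ?_
  have haT : a ∉ T := fun h => Finset.notMem_erase a S (Finset.mem_powerset.1 hT h)
  simp only [hG.mem_map_insert_iff hw haT₀, Finset.card_insert_of_notMem haT, pow_succ]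
  ring

/-- The finite differences of `g` at `0` of order above the level vanish. -/
theorem alternating_sum_choose_eq_zero (hG : IsRealizingSetTransformation g G) {l s : ℕ}
    (hl : IsSetTransformationOfLevel G l) (hls : l < s) (hs : s ≤ Fintype.card N) :
    ∑ i ∈ Finset.range (s + 1), (s.choose i : ℤ) * ((-1) ^ i * (g i : ℤ)) = 0 := by
  obtain ⟨S, -, rfl⟩ := Finset.exists_subset_card_eq (s := (Finset.univ : Finset N)) hs
  have hcard (T : Finset N) : (g T.card : ℤ) = ∑ w : W, if w ∈ G T then 1 else 0 := by
    simp [← hG.card_map T]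
  have key : ∑ T ∈ S.powerset, (-1 : ℤ) ^ T.card * (g T.card : ℤ) = 0 := by
    simp only [hcard, Finset.mul_sum]
    rw [Finset.sum_comm]
    exact Finset.sum_eq_zero fun w _ => hG.alternating_sum_indicator_eq_zero hl hls w
  rw [Finset.sum_powerset_apply_card (fun i => (-1 : ℤ) ^ i * (g i : ℤ))] at key
  simpa only [nsmul_eq_mul] using key

end IsRealizingSetTransformation

/-- If a power of `p` exceeds the level but not the size of the ground set, then `m` divides it. -/
theorem HasZeroOneProperty.dvd_prime_pow_of_level_lt {g : ℕ → ℕ} {m p : ℕ}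
    (hg : HasZeroOneProperty m p g) (hp : p.Prime) {N W : Type*} [Fintype N] [DecidableEq N]
    [Fintype W] [DecidableEq W] {G : Finset N → Finset W} (hG : IsRealizingSetTransformation g G)
    {l k : ℕ} (hl : IsSetTransformationOfLevel G l) (hlk : l < p ^ k)
    (hk : p ^ k ≤ Fintype.card N) : m ∣ p ^ k := by
  have h := hG.alternating_sum_choose_eq_zero hl hlk hk
  have hg0 : (p : ℤ) ∣ g 0 :=
    Int.natCast_dvd_natCast.2 ((Nat.modEq_zero_iff_dvd).1 ((hg 0).1 rfl))
  have hlow : (p : ℤ) ∣ ∑ i ∈ Finset.range (p ^ k),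
      ((p ^ k).choose i : ℤ) * ((-1) ^ i * (g i : ℤ)) := by
    refine Finset.dvd_sum fun i hi => ?_
    rcases Nat.eq_zero_or_pos i with rfl | hi0
    · simpa using hg0
    · exact (Int.natCast_dvd_natCast.2
        (hp.dvd_choose_pow hi0.ne' (Finset.mem_range.1 hi).ne)).mul_right _
  rw [Finset.sum_range_succ, Nat.choose_self, Nat.cast_one, one_mul] at h
  have htop : (p : ℤ) ∣ (-1) ^ (p ^ k) * (g (p ^ k) : ℤ) := by
    rw [← dvd_add_right hlow, h]
    exact dvd_zero _
  have hgp : p ∣ g (p ^ k) := by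
    rw [(isUnit_one.neg.pow _).dvd_mul_left] at htop
    exact Int.natCast_dvd_natCast.1 htop
  by_contra hm
  have h1 := (hg (p ^ k)).2 fun h' => hm ((Nat.modEq_zero_iff_dvd).1 h')
  exact hp.one_lt.ne' (Nat.dvd_one.1 (((h1.dvd_iff dvd_rfl)).1 hgp))

/-- Every generalized level is positive at `n ≥ 1`. -/
theorem HasGeneralizedLevel.pos {g l : ℕ → ℕ} {m p : ℕ} (hl : HasGeneralizedLevel g l)
    (hg : HasZeroOneProperty m p g) (hp : p.Prime) (hm : m ≠ 1) {n : ℕ} (hn : 1 ≤ n) :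
    0 < l n := by
  obtain ⟨W, _, _, G, hG, hlevel⟩ := hl (Fin n)
  rw [Fintype.card_fin] at hlevel
  by_contra h
  refine hm (Nat.dvd_one.1 ?_)
  simpa using hg.dvd_prime_pow_of_level_lt hp hG (k := 0) hlevel (by simp; omega) (by simpa)

/-- If `m` has at least two prime factors, every generalized level is at least linear. -/
theorem HasGeneralizedLevel.lt_mul {g l : ℕ → ℕ} {m p : ℕ} (hl : HasGeneralizedLevel g l)
    (hg : HasZeroOneProperty m p g) (hp : p.Prime) (hm : 1 < m.primeFactors.card) {n : ℕ}
    (hn : n ≠ 0) : n < p * l n := by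
  obtain ⟨W, _, _, G, hG, hlevel⟩ := hl (Fin n)
  rw [Fintype.card_fin] at hlevel
  have hle : p ^ Nat.log p n ≤ l n := by
    by_contra! h
    have hdvd := hg.dvd_prime_pow_of_level_lt hp hG hlevel h
      (by simpa using Nat.pow_log_le_self p hn)
    have hsub : m.primeFactors ⊆ {p} :=
      (Nat.primeFactors_mono hdvd (pow_ne_zero _ hp.ne_zero)).trans
        (fun q hq => Finset.mem_singleton.2 ((Nat.prime_dvd_prime_iff_eq
          (Nat.prime_of_mem_primeFactors hq) hp).1 ((Nat.prime_of_mem_primeFactors hq).dvd_of_dvd_pow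
            (Nat.dvd_of_mem_primeFactors hq))))
    exact absurd (Finset.card_le_card hsub) (by simpa using hm)
  calc n < p ^ (Nat.log p n + 1) := Nat.lt_pow_succ_log_self hp.one_lt n
    _ = p * p ^ Nat.log p n := pow_succ' _ _
    _ ≤ p * l n := Nat.mul_le_mul_left p hle

theorem eventually_log_div_log_log_pow_le (k : ℕ) :
    ∀ᶠ n : ℕ in Filter.atTop,
      (Real.log (n : ℝ) / Real.log (Real.log (n : ℝ))) ^ k ≤ (n : ℝ) := by
  have hlog : Filter.Tendsto (fun n : ℕ => Real.log (n : ℝ)) Filter.atTop Filter.atTop :=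
    Real.tendsto_log_atTop.comp tendsto_natCast_atTop_atTop
  have hpow := tendsto_natCast_atTop_atTop.eventually
    ((Real.isLittleO_pow_log_id_atTop (n := k)).bound one_pos)
  filter_upwards [hpow, hlog.eventually_ge_atTop 0,
    (Real.tendsto_log_atTop.comp hlog).eventually_ge_atTop 1] with n hn h0 h1
  have hle : Real.log (n : ℝ) ^ k ≤ (n : ℝ) := by
    simpa [abs_of_nonneg h0] using hn
  exact (pow_le_pow_left₀ (div_nonneg h0 (zero_le_one.trans h1)) (div_le_self h0 h1) k).trans hle

theorem mainTheorem10 (m p r : ℕ) (hp : p.Prime) (hm : 1 < m) (hm' : ¬ m.Prime)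
    (hr : m.primeFactors.card = r) :
    ∃ c : ℝ, 0 < c ∧ ∃ n₀ : ℕ, ∀ g : ℕ → ℕ,
      IsCardinalityTransformationFunction g → HasZeroOneProperty m p g →
        (∃ l : ℕ → ℕ, HasGeneralizedLevel g l) ∧
        ∀ l : ℕ → ℕ, HasGeneralizedLevel g l →
          ∀ n : ℕ, n₀ ≤ n →
            c * (Real.log (n : ℝ) / Real.log (Real.log (n : ℝ))) ^ (r - 1) ≤ (l n : ℝ) := by
  obtain ⟨n₁, hn₁⟩ := Filter.eventually_atTop.1 (eventually_log_div_log_log_pow_le (r - 1))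
  have hp0 : (0 : ℝ) < p := Nat.cast_pos.2 hp.pos
  refine ⟨(p : ℝ)⁻¹, inv_pos.2 hp0, max n₁ 1, fun g hg hgm => ⟨⟨fun n => n, fun N _ _ => ?_⟩,
    fun l hl n hn => ?_⟩⟩
  · obtain ⟨W, hW, hW', G, hG⟩ := hg N
    exact ⟨W, hW, hW', G, hG, fun w => ⟨Finset.univ, le_rfl, by simp [hG.map_ground]⟩⟩
  have hn1 : 1 ≤ n := (le_max_right _ _).trans hn
  rw [inv_mul_le_iff₀ hp0]
  rcases le_or_gt r 1 with hr1 | hr1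
  · rw [Nat.sub_eq_zero_of_le hr1, pow_zero]
    exact_mod_cast Nat.mul_pos hp.pos (hl.pos hgm hp hm.ne' hn1)
  · refine (hn₁ n ((le_max_left _ _).trans hn)).trans ?_
    exact_mod_cast (hl.lt_mul hgm hp (hr ▸ hr1) (Nat.one_le_iff_ne_zero.1 hn1)).le
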